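/- Let $n\ge 3$ and $2\le k\le n-1$, and let $\mathcal I$ be the set of all $k$-element subsets of $\{1,\dots,n\}$. For $I\in\mathcal I$ let $\mathbb Z^k_I=\{\sum_{i\in I}x_ie_i: x_i\in\mathbb Z\}\subset\mathbb Z^n$ and let $\pi_I:\mathbb Z^n\to\mathbb Z^k_I$ be the orthogonal projection. Given $\mathbf p=(p_I)_{I\in\mathcal I}\in[0,1]^{\mathcal I}$, let $\omega_I(u)$, for $I\in\mathcal I$ and $u\in\mathbb Z^k_I$, be independent Bernoulli random variables with values in $\{0,1\}$ and means $p_I$, and let $\mathbb P_{\mathbf p}$ be the law on $\{0,1\}^{\mathbb Z^n}$ of the configuration $\omega$ given by $\omega(v)=\prod_{I\in\mathcal I}\omega_I(\pi_I(v))$ for $v\in\mathbb Z^n$. A site $v$ is open if $\omega(v)=1$. Let $[o\leftrightarrow\partial B(K)]$ be the event that the origin $o$ is connected to some site at $\ell_\infty$-distance $K$ from $o$ by a nearest-neighbour path in $\mathbb Z^n$ all of whose sites (endpoints included) are open, and let $[o\nleftrightarrow\infty]$ be the event that $o$ does not belong to an infinite connected component of open sites. Then there is $\varepsilon=\varepsilon(n,k)>0$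 such that for every $\mathbf p\in[0,1]^{\mathcal I}$ with $1-\varepsilon<p_I<1$ for all $I\in\mathcal I$, there exist constants $c=c(\mathbf p)>0$ and $\alpha=\alpha(\mathbf p)>0$ such that $$\mathbb P_{\mathbf p}\big(o\leftrightarrow\partial B(K),\ o\nleftrightarrow\infty\big)\ \ge\ c\,K^{-\alpha}\qquad\text{for every integer } K>0.$$ -/

import Mathlib

open MeasureTheory ProbabilityTheory

namespace HyperplanePercolation

/-- The sites of the lattice `ℤⁿ`; the coordinates are indexed by `Fin n`. -/
abbrev Site (n : ℕ) : Type := Fin n → ℤ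

/-- The family of `k`-element subsets of the set of coordinates. -/
abbrev IndexSet (k n : ℕ) : Type := {I : Finset (Fin n) // I.card = k}

/-- The coordinate hyperplane `ℤᵏ_I`: the integer combinations of the `e_i` with `i ∈ I`, that is,
the sites of `ℤⁿ` whose coordinates outside `I` vanish. -/
abbrev CoordHyperplane {k n : ℕ} (I : IndexSet k n) : Type :=
  {x : Site n // ∀ i, i ∉ I.1 → x i = 0}

/-- The orthogonal projection of `ℤⁿ` onto `ℤᵏ_I`. -/
def proj {k n : ℕ} (I : IndexSet k n) (v : Site n) : CoordHyperplane I :=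
  ⟨fun i => if i ∈ I.1 then v i else 0, fun _ hi => if_neg hi⟩

/-- Site configurations on `G`; `true` stands for `1` (open) and `false` for `0` (closed). -/
abbrev Config (G : Type) : Type := G → Bool

/-- Bernoulli site percolation on `G` with parameter `p`: the states of the sites are
independent, and each of them is open with probability `p`. -/
noncomputable def bernoulliSite (G : Type) (p : unitInterval) : Measure (Config G) :=
  Measure.infinitePi fun _ : G => bernoulliMeasure true false p

instance (G : Type) (p : unitInterval) : IsProbabilityMeasure (bernoulliSite G p) := by
  unfold bernoulliSite
  infer_instance

/-- The configuration on `ℤⁿ` given by `ω(v) = ∏_I ω_I(π_I(v))`: the site `v` is open if and only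
if each of its projections `π_I(v)` is open in `ω_I`. -/
def hyperplaneConfig {k n : ℕ} (ω : ∀ I : IndexSet k n, Config (CoordHyperplane I)) :
    Config (Site n) :=
  fun v => decide (∀ I : IndexSet k n, ω I (proj I v) = true)

theorem measurable_hyperplaneConfig {k n : ℕ} :
    Measurable (hyperplaneConfig (k := k) (n := n)) := by
  refine measurable_pi_iff.2 fun v => measurable_to_bool ?_
  have h : (fun ω : ∀ I : IndexSet k n, Config (CoordHyperplane I) =>
      hyperplaneConfig ω v) ⁻¹' {true} = ⋂ I : IndexSet k n, {ω | ω I (proj I v) = true} := by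
    ext ω
    simp [hyperplaneConfig]
  rw [h]
  refine MeasurableSet.iInter fun I => ?_
  have hm : Measurable fun ω : ∀ I : IndexSet k n, Config (CoordHyperplane I) =>
      ω I (proj I v) := (measurable_pi_apply _).comp (measurable_pi_apply I)
  exact hm (measurableSet_singleton true)

/-- The law of Bernoulli `(n,k)`-hyperplane percolation with parameters `p = (p_I)`: the image under
`hyperplaneConfig` of the product of the laws of the percolations `ω_I` on the `ℤᵏ_I`. -/
noncomputable def percolationLaw {k n : ℕ} (p : IndexSet k n → unitInterval) :
    Measure (Config (Site n)) :=
  (Measure.pi fun I : IndexSet k n => bernoulliSite (CoordHyperplane I) (p I)).map hyperplaneConfig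

instance {k n : ℕ} (p : IndexSet k n → unitInterval) :
    IsProbabilityMeasure (percolationLaw p) :=
  Measure.isProbabilityMeasure_map measurable_hyperplaneConfig.aemeasurable

/-- The `ℤⁿ` lattice: two sites are adjacent when their `ℓ¹`-distance is one. -/
def lattice (n : ℕ) : SimpleGraph (Site n) where
  Adj x y := ∑ i, |x i - y i| = 1
  symm := ⟨fun x y h => by simpa only [abs_sub_comm] using h⟩
  loopless := ⟨fun x h => by simp at h⟩

/-- `x ↔ y` in `η`: some path of `η`-open sites starts at `x` and ends at `y`. -/
def Connected {n : ℕ} (η : Config (Site n)) (x y : Site n) : Prop :=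
  ∃ γ : (lattice n).Walk x y, γ.IsPath ∧ ∀ z ∈ γ.support, η z = true

/-- The cluster of `x` in `η`, which is empty when `x` is closed. -/
def cluster {n : ℕ} (η : Config (Site n)) (x : Site n) : Set (Site n) :=
  {y | Connected η x y}

/-- The sites at `ℓ^∞`-distance exactly `K` from the origin. -/
def boxBoundary (n K : ℕ) : Set (Site n) :=
  {x | (∀ i, |x i| ≤ (K : ℤ)) ∧ ∃ i, |x i| = (K : ℤ)}

/-- The event that the origin is connected to a site of `∂B(K)`. -/
def connectedToBoundary (n K : ℕ) : Set (Config (Site n)) :=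
  {η | ∃ y ∈ boxBoundary n K, Connected η 0 y}

/-- The event that the origin belongs to an infinite cluster. -/
def connectedToInfinity (n : ℕ) : Set (Config (Site n)) :=
  {η | (cluster η 0).Infinite}

end HyperplanePercolation

/-!
Write `n = d + 1` and call the zeroth coordinate vertical. A staircase in `ℤᵈ` that steps
cyclically in the coordinate directions carries a vertical strip of length `M` and height `K` in
`ℤⁿ`. The barrier event prescribes `O(M)` of the variables `ω_I(u)`: the projections of the bottom
of the strip are open, while the other projections of the sites next to the bottom, below it and in
the layer above the strip are closed. This confines the cluster of the origin to a finite set.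

Given the barrier, the bottom of the strip is open, and a closed point of the strip has a closed
projection to some hyperplane that contains the vertical direction. As `k ≥ 2`, such a hyperplane
also contains a horizontal direction, so at most `d` points of the strip share a projection to it.
If the origin is not connected to height `K`, then a `*`-connected path of at least `M + 1` closed
points crosses the strip, which forces at least `(M + 1) / d` variables independent of the barrier
to vanish. By a Peierls bound the conditional probability of this is at most `1 / 2` as soon as the
densities `p_I` are close to `1` and `M` is a large multiple of `log K`. The barrier itself has
probability at least `exp (-O(M))`, which is then a power of `K`.
-/

namespace HyperplanePercolation

section StarCrossing

open SimpleGraph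

theorem sum_range_left_add_top_eq_bottom_add_right {A : Type*} [AddCommMonoid A] {M K : ℕ}
    {e v : ℕ → ℕ → A}
    (h : ∀ j < M, ∀ i < K, v j i + e j (i + 1) = e j i + v (j + 1) i) :
    ∑ i ∈ Finset.range K, v 0 i + ∑ j ∈ Finset.range M, e j K =
      ∑ j ∈ Finset.range M, e j 0 + ∑ i ∈ Finset.range K, v M i := by
  have column : ∀ j < M, ∀ L ≤ K, ∑ i ∈ Finset.range L, v j i + e j L =
      e j 0 + ∑ i ∈ Finset.range L, v (j + 1) i := by
    intro j hj L
    induction L with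
    | zero => simp
    | succ L ih =>
      intro hL
      rw [Finset.sum_range_succ, Finset.sum_range_succ, add_assoc, h j hj L hL, ← add_assoc,
        ih (by omega), add_assoc]
  induction M with
  | zero => simp
  | succ M ih =>
    rw [Finset.sum_range_succ, Finset.sum_range_succ, ← add_assoc,
      ih (fun j hj => h j (by omega)) (fun j hj => column j (by omega)), add_assoc,
      column M (by omega) K le_rfl, add_assoc]

/-- The flux of the pair `(R, X)` of sets of vertices along the edge from `a` to `b`: it is `1` if
the edge leads from `R` to `X`, `-1` if it leads from `X` to `R`, and `0` if it does neither, for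
disjoint `R` and `X`. -/
noncomputable def flux {V : Type*} (R X : Set V) (a b : V) : ℤ :=
  R.indicator 1 a * X.indicator 1 b - X.indicator 1 a * R.indicator 1 b

theorem flux_of_notMem {V : Type*} {R X : Set V} {a b : V} (ha : a ∉ X) (hb : b ∉ X) :
    flux R X a b = 0 := by
  simp [flux, ha, hb]

theorem flux_eq_indicator_sub {V : Type*} {R X : Set V} {a b : V} (hRX : Disjoint R X)
    (hab : a ∈ R → b ∉ R → b ∈ X) (hba : b ∈ R → a ∉ R → a ∈ X) :
    flux R X a b = R.indicator 1 a - R.indicator 1 b := by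
  have haX := fun h : a ∈ R => Set.disjoint_left.1 hRX h
  have hbX := fun h : b ∈ R => Set.disjoint_left.1 hRX h
  by_cases ha : a ∈ R <;> by_cases hb : b ∈ R <;> simp_all [flux]

/-- The `*`-adjacency on the quadrant `ℕ²`: two distinct points are adjacent when their
`ℓ^∞`-distance is one. Here `1` stands for `(1, 1)`. -/
def starGraph : SimpleGraph (ℕ × ℕ) where
  Adj x y := x ≠ y ∧ x ≤ y + 1 ∧ y ≤ x + 1
  symm := ⟨fun _ _ h => ⟨h.1.symm, h.2.2, h.2.1⟩⟩
  loopless := ⟨fun _ h => h.1 rfl⟩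

/-- The union of the `*`-clusters of `C` that meet the left side `{0} × ℕ` of the quadrant. -/
def leftStarCluster (C : Set (ℕ × ℕ)) : Set (ℕ × ℕ) :=
  {x | ∃ (h : ℕ) (w : starGraph.Walk (0, h) x), ∀ z ∈ w.support, z ∈ C}

theorem leftStarCluster_subset (C : Set (ℕ × ℕ)) : leftStarCluster C ⊆ C :=
  fun _ ⟨_, w, hw⟩ => hw _ w.end_mem_support

theorem mem_leftStarCluster_of_mem {C : Set (ℕ × ℕ)} {h : ℕ} (hC : (0, h) ∈ C) :
    (0, h) ∈ leftStarCluster C :=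
  ⟨h, .nil, by simpa using hC⟩

theorem mem_leftStarCluster_of_le {C : Set (ℕ × ℕ)} {x y : ℕ × ℕ} (hx : x ∈ leftStarCluster C)
    (hy : y ∈ C) (hxy : x ≤ y + 1) (hyx : y ≤ x + 1) : y ∈ leftStarCluster C := by
  obtain rfl | hne := eq_or_ne x y
  · exact hx
  obtain ⟨h, w, hw⟩ := hx
  have hadj : starGraph.Adj x y := ⟨hne, hxy, hyx⟩
  refine ⟨h, w.concat hadj, fun z hz => ?_⟩
  rw [Walk.support_concat, List.mem_append, List.mem_singleton] at hz
  exact hz.elim (hw z) fun hz => hz ▸ hy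

theorem hasse_adj_right (j h : ℕ) : (hasse (ℕ × ℕ)).Adj (j, h) (j + 1, h) := by
  simp

theorem hasse_adj_up (j h : ℕ) : (hasse (ℕ × ℕ)).Adj (j, h) (j, h + 1) := by
  simp

variable {M K : ℕ} {R C : Set (ℕ × ℕ)}

/-- Within a unit square all points of `C` belong to the same `*`-cluster, so the flux along its
sides either vanishes or is a difference of values of the indicator of `R`. -/
theorem flux_square (hRC : Disjoint R C)
    (hbdry : ∀ a ≤ (M, K), ∀ b ≤ (M, K), (hasse (ℕ × ℕ)).Adj a b → a ∈ R → b ∉ R → b ∈ C)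
    {j h : ℕ} (hj : j < M) (hh : h < K) :
    flux R (leftStarCluster C) (j, h) (j, h + 1) +
        flux R (leftStarCluster C) (j, h + 1) (j + 1, h + 1) =
      flux R (leftStarCluster C) (j, h) (j + 1, h) +
        flux R (leftStarCluster C) (j + 1, h) (j + 1, h + 1) := by
  set X := leftStarCluster C
  have corners : ∀ a ∈ ({(j, h), (j, h + 1), (j + 1, h), (j + 1, h + 1)} : Set (ℕ × ℕ)),
      a ∈ Set.Icc (j, h) (j + 1, h + 1) := by
    simp [Prod.le_def]
  have le_add_one : ∀ a ∈ Set.Icc (j, h) (j + 1, h + 1), ∀ b ∈ Set.Icc (j, h) (j + 1, h + 1),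
      a ≤ b + 1 := fun a ha b hb => ha.2.trans (add_le_add_left hb.1 1)
  by_cases hX : ∃ z ∈ Set.Icc (j, h) (j + 1, h + 1), z ∈ X
  · obtain ⟨z, hz, hzX⟩ := hX
    have mem_X : ∀ a ∈ Set.Icc (j, h) (j + 1, h + 1), ∀ b ∈ Set.Icc (j, h) (j + 1, h + 1),
        (hasse (ℕ × ℕ)).Adj a b → a ∈ R → b ∉ R → b ∈ X := fun a ha b hb hab haR hbR =>
      have hle : (j + 1, h + 1) ≤ (M, K) := ⟨hj, hh⟩
      mem_leftStarCluster_of_le hzX (hbdry a (ha.2.trans hle) b (hb.2.trans hle) hab haR hbR)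
        (le_add_one z hz b hb) (le_add_one b hb z hz)
    have key : ∀ a ∈ Set.Icc (j, h) (j + 1, h + 1), ∀ b ∈ Set.Icc (j, h) (j + 1, h + 1),
        (hasse (ℕ × ℕ)).Adj a b → flux R X a b = R.indicator 1 a - R.indicator 1 b :=
      fun a ha b hb hab => flux_eq_indicator_sub (hRC.mono_right (leftStarCluster_subset C))
        (mem_X a ha b hb hab) (mem_X b hb a ha hab.symm)
    rw [key _ (corners _ (by simp)) _ (corners _ (by simp)) (hasse_adj_up j h),
      key _ (corners _ (by simp)) _ (corners _ (by simp)) (hasse_adj_right j (h + 1)),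
      key _ (corners _ (by simp)) _ (corners _ (by simp)) (hasse_adj_right j h),
      key _ (corners _ (by simp)) _ (corners _ (by simp)) (hasse_adj_up (j + 1) h)]
    ring
  · have notMem_X : ∀ a ∈ ({(j, h), (j, h + 1), (j + 1, h), (j + 1, h + 1)} : Set (ℕ × ℕ)),
        a ∉ X := fun a ha haX => hX ⟨a, corners a ha, haX⟩
    simp only [Set.mem_insert_iff, Set.mem_singleton_iff, forall_eq_or_imp, forall_eq] at notMem_X
    obtain ⟨h₁, h₂, h₃, h₄⟩ := notMem_X
    rw [flux_of_notMem h₁ h₂, flux_of_notMem h₂ h₄, flux_of_notMem h₁ h₃, flux_of_notMem h₃ h₄]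

theorem sum_flux_left (hbot : (0, 0) ∈ R) (htop : (0, K) ∉ R) (hRC : Disjoint R C)
    (hbdry : ∀ a ≤ (0, K), ∀ b ≤ (0, K), (hasse (ℕ × ℕ)).Adj a b → a ∈ R → b ∉ R → b ∈ C) :
    ∑ i ∈ Finset.range K, flux R (leftStarCluster C) (0, i) (0, i + 1) = 1 := by
  calc
    _ = ∑ i ∈ Finset.range K, (R.indicator 1 (0, i) - R.indicator 1 (0, i + 1) : ℤ) := by
      refine Finset.sum_congr rfl fun i hi => ?_
      have hi : i < K := Finset.mem_range.1 hi
      have hle : ((0, i) : ℕ × ℕ) ≤ (0, K) := ⟨le_rfl, hi.le⟩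
      have hle' : ((0, i + 1) : ℕ × ℕ) ≤ (0, K) := ⟨le_rfl, hi⟩
      have hadj := hasse_adj_up 0 i
      exact flux_eq_indicator_sub (hRC.mono_right (leftStarCluster_subset C))
        (fun ha hb => mem_leftStarCluster_of_mem (hbdry _ hle _ hle' hadj ha hb))
        (fun hb ha => mem_leftStarCluster_of_mem (hbdry _ hle' _ hle hadj.symm hb ha))
    _ = 1 := by
      rw [Finset.sum_range_sub' (fun i => R.indicator 1 (0, i)), Set.indicator_of_mem hbot,
        Set.indicator_of_notMem htop]
      rfl

/-- By `flux_square` the flux is independent of the path. It is `1` along the left side of the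
rectangle and vanishes along the bottom and top sides, so some edge of the right side must carry
flux as well. -/
theorem exists_star_crossing (hbot : ∀ j ≤ M, (j, 0) ∈ R) (htop : ∀ j ≤ M, (j, K) ∉ R)
    (hRC : Disjoint R C)
    (hbdry : ∀ a ≤ (M, K), ∀ b ≤ (M, K), (hasse (ℕ × ℕ)).Adj a b → a ∈ R → b ∉ R → b ∈ C) :
    ∃ (h h' : ℕ) (w : starGraph.Walk (0, h) (M, h')), ∀ z ∈ w.support, z ∈ C := by
  set X := leftStarCluster C
  have hRX : Disjoint R X := hRC.mono_right (leftStarCluster_subset C)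
  have hle : ((0, K) : ℕ × ℕ) ≤ (M, K) := ⟨M.zero_le, le_rfl⟩
  have left : ∑ i ∈ Finset.range K, flux R X (0, i) (0, i + 1) = 1 :=
    sum_flux_left (hbot 0 M.zero_le) (htop 0 M.zero_le) hRC
      fun a ha b hb => hbdry a (ha.trans hle) b (hb.trans hle)
  have bottom : ∑ j ∈ Finset.range M, flux R X (j, 0) (j + 1, 0) = 0 :=
    Finset.sum_eq_zero fun j hj => flux_of_notMem
      (Set.disjoint_left.1 hRX (hbot j (Finset.mem_range.1 hj).le))
      (Set.disjoint_left.1 hRX (hbot (j + 1) (Finset.mem_range.1 hj)))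
  have top : ∑ j ∈ Finset.range M, flux R X (j, K) (j + 1, K) = 0 :=
    Finset.sum_eq_zero fun j hj => by
      simp [flux, htop j (Finset.mem_range.1 hj).le, htop (j + 1) (Finset.mem_range.1 hj)]
  have right : ∑ i ∈ Finset.range K, flux R X (M, i) (M, i + 1) ≠ 0 := by
    have := sum_range_left_add_top_eq_bottom_add_right
      (e := fun j i => flux R X (j, i) (j + 1, i)) (v := fun j i => flux R X (j, i) (j, i + 1))
      fun j hj i hi => flux_square hRC hbdry hj hi
    rw [left, bottom, top, add_zero, zero_add] at this
    exact this ▸ one_ne_zero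
  obtain ⟨i, -, hi⟩ := Finset.exists_ne_zero_of_sum_ne_zero right
  have : ∃ h', (M, h') ∈ X := by
    by_contra! hX
    exact hi (flux_of_notMem (hX i) (hX (i + 1)))
  obtain ⟨h', h, w, hw⟩ := this
  exact ⟨h, h', w, hw⟩

end StarCrossing

section WalkCounting

open SimpleGraph

variable {V : Type*} [DecidableEq V] (G : SimpleGraph V) [G.LocallyFinite]

/-- The vertex sets of the walks of length `m` that start at `x`. -/
def walkVertexSets : ℕ → V → Finset (Finset V)
  | 0, x => {{x}}
  | m + 1, x => (G.neighborFinset x).biUnion fun y => (walkVertexSets m y).image (insert x)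

variable {G}

theorem card_walkVertexSets_le {D : ℕ} (hD : ∀ x, G.degree x ≤ D) (m : ℕ) (x : V) :
    (walkVertexSets G m x).card ≤ D ^ m := by
  induction m generalizing x with
  | zero => simp [walkVertexSets]
  | succ m ih =>
    calc
      (walkVertexSets G (m + 1) x).card ≤ G.degree x * D ^ m :=
        Finset.card_biUnion_le_card_mul _ _ _ fun y _ => Finset.card_image_le.trans (ih y)
      _ ≤ D ^ (m + 1) := by
        rw [pow_succ']
        exact Nat.mul_le_mul_right _ (hD x)

theorem toFinset_support_mem_walkVertexSets {x y : V} (w : G.Walk x y) :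
    w.support.toFinset ∈ walkVertexSets G w.length x := by
  induction w with
  | nil => simp [walkVertexSets]
  | cons hadj w ih =>
    rw [Walk.length_cons, walkVertexSets, Finset.mem_biUnion]
    exact ⟨_, (G.mem_neighborFinset _ _).2 hadj, Finset.mem_image.2 ⟨_, ih, by simp⟩⟩

theorem exists_mem_walkVertexSets {x y : V} {m : ℕ} (w : G.Walk x y) (hw : m ≤ w.bypass.length) :
    ∃ S ∈ walkVertexSets G m x, S.card = m + 1 ∧ ∀ z ∈ S, z ∈ w.support := by
  have hlen : (w.bypass.take m).length = m := by rw [Walk.take_length, min_eq_left hw]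
  have hpath : (w.bypass.take m).IsPath := w.bypass_isPath.take m
  refine ⟨(w.bypass.take m).support.toFinset, ?_, ?_, fun z hz => ?_⟩
  · have := toFinset_support_mem_walkVertexSets (w.bypass.take m)
    rwa [hlen] at this
  · rw [List.toFinset_card_of_nodup hpath.support_nodup, Walk.length_support, hlen]
  · exact w.support_bypass_subset_support
      (w.bypass.isSubwalk_take m |>.support_subset (List.mem_toFinset.1 hz))

instance : starGraph.LocallyFinite := fun x =>
  Fintype.ofFinset ((Finset.Icc (x - 1) (x + 1)).erase x) fun y => by
    rw [Finset.mem_erase, Finset.mem_Icc, tsub_le_iff_right, ne_comm]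
    rfl

theorem degree_starGraph_le (x : ℕ × ℕ) : starGraph.degree x ≤ 8 := by
  have hcard : (Finset.Icc (x - 1) (x + 1)).card ≤ 3 * 3 := by
    rw [Finset.card_Icc_prod]
    refine Nat.mul_le_mul ?_ ?_ <;>
    · simp only [Nat.card_Icc, Prod.fst_add, Prod.fst_sub, Prod.snd_add, Prod.snd_sub,
        Prod.fst_one, Prod.snd_one]
      omega
  rw [← card_neighborSet_eq_degree]
  calc
    _ = ((Finset.Icc (x - 1) (x + 1)).erase x).card := Fintype.card_ofFinset _ _
    _ = (Finset.Icc (x - 1) (x + 1)).card - 1 :=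
      Finset.card_erase_of_mem (by simp)
    _ ≤ 8 := by omega

theorem fst_le_add_length {x y : ℕ × ℕ} (w : starGraph.Walk x y) : y.1 ≤ x.1 + w.length := by
  induction w with
  | nil => simp
  | cons hadj w ih =>
    have := hadj.2.2.1
    rw [Walk.length_cons]
    simp only [Prod.fst_add, Prod.fst_one] at this
    omega

/-- The vertex sets of the `*`-paths with `M + 1` points in the rectangle `[0, M] × [1, K]` that
start on its left side. Every `*`-crossing of the rectangle contains one of them. -/
def starPathSets (M K : ℕ) : Finset (Finset (ℕ × ℕ)) :=
  ((Finset.Icc 1 K).biUnion fun h => walkVertexSets starGraph M (0, h)).filter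
    fun S => S.card = M + 1 ∧ S ⊆ Finset.Icc (0, 1) (M, K)

theorem card_starPathSets_le (M K : ℕ) : (starPathSets M K).card ≤ K * 8 ^ M := by
  refine (Finset.card_filter_le _ _).trans ?_
  simpa using Finset.card_biUnion_le_card_mul (Finset.Icc 1 K)
    (fun h => walkVertexSets starGraph M (0, h)) (8 ^ M)
    fun h _ => card_walkVertexSets_le degree_starGraph_le M (0, h)

theorem exists_mem_starPathSets {M K h h' : ℕ} (w : starGraph.Walk (0, h) (M, h'))
    (hw : ∀ z ∈ w.support, z ∈ Finset.Icc (0, 1) (M, K)) :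
    ∃ S ∈ starPathSets M K, ∀ z ∈ S, z ∈ w.support := by
  have hlen : M ≤ w.bypass.length := by simpa using fst_le_add_length w.bypass
  obtain ⟨S, hS, hcard, hsub⟩ := exists_mem_walkVertexSets w hlen
  have hstart := Finset.mem_Icc.1 (hw _ w.start_mem_support)
  refine ⟨S, Finset.mem_filter.2 ⟨Finset.mem_biUnion.2 ⟨h, ?_, hS⟩, hcard, fun z hz =>
    hw z (hsub z hz)⟩, hsub⟩
  exact Finset.mem_Icc.2 ⟨hstart.1.2, hstart.2.2⟩

end WalkCounting

section Lattice

variable {k n : ℕ} {η : Config (Site n)} {x y z : Site n}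

theorem lattice_adj_add_single {i : Fin n} {u : ℤ} (hu : |u| = 1) :
    (lattice n).Adj x (x + Pi.single i u) := by
  have : ∑ i', |x i' - (x i' + (Pi.single i u : Site n) i')| = 1 := by
    rw [Finset.sum_eq_single i (fun i' _ hi' => by simp [hi']) (by simp)]
    simpa using hu
  exact this

theorem exists_eq_add_single_of_adj (h : (lattice n).Adj x y) :
    ∃ (i : Fin n) (u : ℤ), |u| = 1 ∧ y = x + Pi.single i u := by
  have hsum : ∑ i, |x i - y i| = 1 := h
  obtain ⟨i, hi⟩ : ∃ i, x i - y i ≠ 0 := by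
    by_contra! hxy
    simp [hxy] at hsum
  have split := Finset.add_sum_erase Finset.univ (fun i' => |x i' - y i'|) (Finset.mem_univ i)
  have hpos : 0 < |x i - y i| := abs_pos.2 hi
  have hnonneg : 0 ≤ ∑ i' ∈ Finset.univ.erase i, |x i' - y i'| :=
    Finset.sum_nonneg fun _ _ => abs_nonneg _
  have hrest : ∀ i' ≠ i, x i' = y i' := fun i' hi' => by
    have := (Finset.sum_eq_zero_iff_of_nonneg fun _ _ => abs_nonneg _).1
      (show ∑ i' ∈ Finset.univ.erase i, |x i' - y i'| = 0 by omega) i' (by simp [hi'])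
    simpa [sub_eq_zero] using this
  refine ⟨i, y i - x i, by rw [abs_sub_comm]; omega, funext fun i' => ?_⟩
  obtain rfl | hi' := eq_or_ne i' i
  · simp
  · simp [hi', hrest i' hi']

theorem abs_le_add_one_of_adj (h : (lattice n).Adj x y) (i : Fin n) : |y i| ≤ |x i| + 1 := by
  obtain ⟨i', u, hu, rfl⟩ := exists_eq_add_single_of_adj h
  refine (abs_add_le (x i) _).trans ((add_le_add_iff_left _).2 ?_)
  obtain rfl | hi := eq_or_ne i i'
  · simp [hu]
  · simp [hi]

theorem Connected.of_walk (w : (lattice n).Walk x y) (hw : ∀ z ∈ w.support, η z = true) :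
    Connected η x y := by
  classical
  exact ⟨w.bypass, w.bypass_isPath, fun z hz => hw z (w.support_bypass_subset_support hz)⟩

theorem Connected.refl (hx : η x = true) : Connected η x x :=
  .of_walk .nil (by simpa using hx)

theorem Connected.concat (h : Connected η x y) (hyz : (lattice n).Adj y z) (hz : η z = true) :
    Connected η x z := by
  obtain ⟨w, -, hw⟩ := h
  refine .of_walk (w.concat hyz) fun u hu => ?_
  rw [SimpleGraph.Walk.support_concat, List.mem_append, List.mem_singleton] at hu
  exact hu.elim (hw u) fun hu => hu ▸ hz

theorem Connected.open_right (h : Connected η x y) : η y = true :=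
  let ⟨w, _, hw⟩ := h
  hw y w.end_mem_support

theorem exists_mem_support_boxBoundary {K : ℕ} (w : (lattice n).Walk x y)
    (hx : ∀ i, |x i| ≤ (K : ℤ)) (hy : ∃ i, (K : ℤ) ≤ |y i|) :
    ∃ z ∈ w.support, z ∈ boxBoundary n K := by
  induction w with
  | nil =>
    obtain ⟨i, hi⟩ := hy
    exact ⟨_, by simp, hx, i, le_antisymm (hx i) hi⟩
  | @cons u v _ huv w ih =>
    by_cases hu : ∃ i, |u i| = (K : ℤ)
    · exact ⟨u, by simp, hx, hu⟩
    · push Not at hu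
      have hv : ∀ i, |v i| ≤ (K : ℤ) := fun i => (abs_le_add_one_of_adj huv i).trans
        (Int.add_one_le_of_lt ((hx i).lt_of_ne (hu i)))
      obtain ⟨z, hz, hzK⟩ := ih hv hy
      exact ⟨z, by simp [hz], hzK⟩

theorem Connected.mem_connectedToBoundary {K : ℕ} (h : Connected η 0 y)
    (hy : ∃ i, (K : ℤ) ≤ |y i|) : η ∈ connectedToBoundary n K := by
  classical
  obtain ⟨w, -, hw⟩ := h
  obtain ⟨z, hz, hzK⟩ := exists_mem_support_boxBoundary w (by simp) hy
  exact ⟨z, hzK, .of_walk (w.takeUntil z hz)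
    fun u hu => hw u (w.support_takeUntil_subset_support hz hu)⟩

theorem cluster_subset {S : Set (Site n)} (hx : x ∈ S)
    (hS : ∀ y ∈ S, ∀ z, (lattice n).Adj y z → η z = true → z ∈ S) : cluster η x ⊆ S := by
  rintro y ⟨w, -, hw⟩
  induction w with
  | nil => exact hx
  | cons h w ih =>
    have hw' : ∀ z ∈ w.support, η z = true := fun z hz => hw z (by simp [hz])
    exact ih (hS _ hx _ h (hw' _ w.start_mem_support)) hw'

end Lattice

section Projections

/-- A joint configuration of the percolations on all the coordinate hyperplanes `ℤᵏ_I`. -/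
abbrev ConfigFamily (k n : ℕ) : Type := ∀ I : IndexSet k n, Config (CoordHyperplane I)

/-- The disjoint union of the coordinate hyperplanes `ℤᵏ_I`, which indexes the independent
variables `ω_I(u)`. -/
abbrev HyperplaneSite (k n : ℕ) : Type := Σ I : IndexSet k n, CoordHyperplane I

variable {k n : ℕ} {ω : ConfigFamily k n} {I J : IndexSet k n} {x y : Site n}

/-- The projection `π_I(x)`, as a point of the copy of `ℤᵏ_I` in the disjoint union. -/
def sigmaProj (I : IndexSet k n) (x : Site n) : HyperplaneSite k n := ⟨I, proj I x⟩

theorem hyperplaneConfig_eq_true :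
    hyperplaneConfig ω x = true ↔ ∀ I, ω I (proj I x) = true := by
  simp [hyperplaneConfig]

theorem proj_eq_proj_iff : proj I x = proj I y ↔ ∀ i ∈ I.1, x i = y i := by
  rw [Subtype.ext_iff, funext_iff]
  refine forall_congr' fun i => ?_
  by_cases hi : i ∈ I.1 <;> simp [proj, hi]

theorem sigmaProj_eq_iff : sigmaProj I x = sigmaProj J y ↔ I = J ∧ ∀ i ∈ I.1, x i = y i := by
  constructor
  · intro h
    obtain rfl : I = J := congrArg Sigma.fst h
    exact ⟨rfl, proj_eq_proj_iff.1 (eq_of_heq (Sigma.mk.inj h).2)⟩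
  · rintro ⟨rfl, h⟩
    exact congrArg (Sigma.mk I) (proj_eq_proj_iff.2 h)

theorem exists_indexSet_mem_notMem (hk : 0 < k) (hkn : k < n) {i j : Fin n} (hij : i ≠ j) :
    ∃ I : IndexSet k n, i ∈ I.1 ∧ j ∉ I.1 := by
  obtain ⟨I, hiI, hIj, hI⟩ := Finset.exists_subsuperset_card_eq
    (s := {i}) (t := Finset.univ.erase j) (n := k) (by simpa using hij) hk
    (by simpa using Nat.le_sub_one_of_lt hkn)
  exact ⟨⟨I, hI⟩, hiI (Finset.mem_singleton_self i), fun h => by simpa using hIj h⟩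

theorem exists_indexSet_mem_subset_insert (hk : 0 < k) (I : IndexSet k n) (i : Fin n) :
    ∃ J : IndexSet k n, i ∈ J.1 ∧ J.1 ⊆ insert i I.1 := by
  obtain ⟨J, hiJ, hJI, hJ⟩ := Finset.exists_subsuperset_card_eq
    (s := {i}) (t := insert i I.1) (n := k) (by simp) hk
    (I.2.ge.trans (Finset.card_le_card (Finset.subset_insert i I.1)))
  exact ⟨⟨J, hJ⟩, hiJ (Finset.mem_singleton_self i), hJI⟩

end Projections

section Strip

variable {d : ℕ}

/-- The strip in `ℤ^(d+1)` above the staircase in `ℤᵈ` whose steps go cyclically through the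
coordinate directions: `site d (j, h)` lies at height `h` above the `j`-th vertex of the staircase.
The vertical coordinate is `0`, and the horizontal coordinate `i` is the number of steps in that
direction among the first `j` ones. -/
def site (d : ℕ) (z : ℕ × ℕ) : Site (d + 1) :=
  Fin.cons (z.2 : ℤ) fun i : Fin d => (Nat.count (· ≡ i [MOD d]) z.1 : ℤ)

theorem site_apply_zero (z : ℕ × ℕ) : site d z 0 = z.2 := rfl

theorem site_apply_succ (z : ℕ × ℕ) (i : Fin d) :
    site d z i.succ = Nat.count (· ≡ i [MOD d]) z.1 := rfl

theorem site_zero : site d (0, 0) = 0 := by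
  ext i
  cases i using Fin.cases <;> simp [site]

theorem site_right (hd : 0 < d) (j h : ℕ) :
    site d (j + 1, h) = site d (j, h) + Pi.single (Fin.succ ⟨j % d, j.mod_lt hd⟩) 1 := by
  ext i
  cases i using Fin.cases with
  | zero => simp [site]
  | succ i =>
    have : j ≡ i [MOD d] ↔ i = ⟨j % d, j.mod_lt hd⟩ := by
      rw [Nat.ModEq, Nat.mod_eq_of_lt i.2, Fin.ext_iff, eq_comm]
    simp [site, Nat.count_succ, this, Pi.single_apply, -Fin.succ_mk, (Fin.succ_injective d).eq_iff]

theorem site_up (j h : ℕ) : site d (j, h + 1) = site d (j, h) + Pi.single 0 1 := by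
  ext i
  cases i using Fin.cases <;> simp [site]

theorem lattice_adj_site (hd : 0 < d) {a b : ℕ × ℕ} (hab : (SimpleGraph.hasse (ℕ × ℕ)).Adj a b) :
    (lattice (d + 1)).Adj (site d a) (site d b) := by
  wlog h : a ⋖ b generalizing a b
  · exact (this hab.symm (hab.resolve_left h)).symm
  obtain ⟨j, t⟩ := a
  obtain ⟨j', t'⟩ := b
  obtain ⟨h, rfl⟩ | ⟨h, rfl⟩ := Prod.covBy_iff.1 h
  · obtain rfl := Nat.covBy_iff_add_one_eq.1 h
    exact site_right hd j t ▸ lattice_adj_add_single abs_one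
  · obtain rfl := Nat.covBy_iff_add_one_eq.1 h
    exact site_up j t ▸ lattice_adj_add_single abs_one

theorem eq_of_site_eq_of_modEq {z z' : ℕ × ℕ} {i : Fin d} (hmod : z.1 ≡ z'.1 [MOD d])
    (h0 : site d z 0 = site d z' 0) (hi : site d z i.succ = site d z' i.succ) : z = z' := by
  have hd : 0 < d := i.pos
  rw [site_apply_succ, site_apply_succ, Nat.count_modEq_card _ hd, Nat.count_modEq_card _ hd,
    hmod, Nat.cast_inj, add_left_inj] at hi
  refine Prod.ext ?_ (Nat.cast_injective h0)
  rw [← Nat.div_add_mod z.1 d, ← Nat.div_add_mod z'.1 d, hi, hmod]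

end Strip

section Barrier

/-- The displacements from the bottom of the strip to the sites at whose projections the barrier
prescribes the state: the bottom itself, its horizontal neighbours, the layer below it and the layer
at height `K + 1`, just above the strip. -/
def displacements (d K : ℕ) : Finset (Site (d + 1)) :=
  {0, Pi.single 0 (K + 1 : ℤ)} ∪ Finset.univ.image (fun i => Pi.single i (-1)) ∪
    Finset.univ.image fun i : Fin d => Pi.single i.succ 1

theorem card_displacements_le (d K : ℕ) : (displacements d K).card ≤ 2 * d + 3 := by
  calc
    _ ≤ 2 + Finset.card (Finset.univ : Finset (Fin (d + 1))) +
        Finset.card (Finset.univ : Finset (Fin d)) :=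
      (Finset.card_union_le _ _).trans (add_le_add ((Finset.card_union_le _ _).trans
        (add_le_add Finset.card_le_two Finset.card_image_le)) Finset.card_image_le)
    _ = 2 * d + 3 := by
      rw [Finset.card_univ, Finset.card_univ, Fintype.card_fin, Fintype.card_fin]
      ring

theorem zero_mem_displacements (d K : ℕ) : 0 ∈ displacements d K := by
  simp [displacements]

theorem single_zero_mem_displacements {d K : ℕ} {u : ℤ} (hu : u = -1 ∨ u = K + 1) :
    Pi.single 0 u ∈ displacements d K := by
  obtain rfl | rfl := hu <;> simp [displacements]

theorem single_succ_mem_displacements {d K : ℕ} (i : Fin d) {u : ℤ} (hu : |u| = 1) :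
    Pi.single i.succ u ∈ displacements d K := by
  obtain rfl | rfl := (abs_eq one_pos.le).1 hu <;> simp [displacements]

theorem apply_zero_of_mem_displacements {d K : ℕ} {δ : Site (d + 1)} (hδ : δ ∈ displacements d K) :
    δ 0 ≤ 0 ∨ δ 0 = K + 1 := by
  simp only [displacements, Finset.mem_union, Finset.mem_insert, Finset.mem_singleton,
    Finset.mem_image, Finset.mem_univ, true_and] at hδ
  obtain ((rfl | rfl) | ⟨i, rfl⟩) | ⟨i, rfl⟩ := hδ
  · simp
  · simp
  · cases i using Fin.cases <;> simp
  · simp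

/-- The projections of the bottom of the strip, which is the image of `[0, M] × [0, K]` under
`site d`. -/
def baseProjections (k d M : ℕ) : Finset (HyperplaneSite k (d + 1)) :=
  (Finset.univ ×ˢ Finset.range (M + 1)).image fun (I, j) => sigmaProj I (site d (j, 0))

/-- The points of the hyperplanes at which the barrier prescribes the state. -/
def barrierSupport (k d M K : ℕ) : Finset (HyperplaneSite k (d + 1)) :=
  (Finset.univ ×ˢ Finset.range (M + 1) ×ˢ displacements d K).image
    fun (I, j, δ) => sigmaProj I (site d (j, 0) + δ)

/-- The cylinder event that the variables indexed by `F` take the values given by `b`. -/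
def agreeOn {k n : ℕ} (F : Finset (HyperplaneSite k n)) (b : HyperplaneSite k n → Bool) :
    Set (ConfigFamily k n) :=
  {ω | ∀ v ∈ F, ω v.1 v.2 = b v}

/-- The event that, on `barrierSupport`, exactly the projections of the bottom of the strip are
open. It keeps the cluster of the origin inside `enclosure`. -/
def barrier (k d M K : ℕ) : Set (ConfigFamily k (d + 1)) :=
  agreeOn (barrierSupport k d M K) fun v => decide (v ∈ baseProjections k d M)

/-- The sites at heights between `0` and `K` whose projections to the horizontal coordinate
hyperplanes are projections of the bottom of the strip. -/
def enclosure (k d M K : ℕ) : Set (Site (d + 1)) :=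
  {x | x 0 ∈ Set.Icc (0 : ℤ) K ∧ ∀ I : IndexSet k (d + 1), 0 ∉ I.1 →
    sigmaProj I x ∈ baseProjections k d M}

variable {k d M K : ℕ} {ω : ConfigFamily k (d + 1)} {I : IndexSet k (d + 1)} {x y : Site (d + 1)}

theorem sigmaProj_mem_baseProjections_iff : sigmaProj I x ∈ baseProjections k d M ↔
    ∃ j ≤ M, ∀ i ∈ I.1, x i = site d (j, 0) i := by
  simp only [baseProjections, Finset.mem_image, Finset.mem_product, Finset.mem_univ, true_and,
    Finset.mem_range, Nat.lt_succ_iff, Prod.exists, eq_comm (b := sigmaProj I x),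
    sigmaProj_eq_iff]
  exact ⟨fun ⟨_, j, hj, _, h⟩ => ⟨j, hj, h⟩, fun ⟨j, hj, h⟩ => ⟨I, j, hj, rfl, h⟩⟩

theorem sigmaProj_mem_barrierSupport_iff : sigmaProj I x ∈ barrierSupport k d M K ↔
    ∃ j ≤ M, ∃ δ ∈ displacements d K, ∀ i ∈ I.1, x i = site d (j, 0) i + δ i := by
  simp only [barrierSupport, Finset.mem_image, Finset.mem_product, Finset.mem_univ, true_and,
    Finset.mem_range, Nat.lt_succ_iff, Prod.exists, eq_comm (b := sigmaProj I x),
    sigmaProj_eq_iff, Pi.add_apply]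
  exact ⟨fun ⟨_, j, δ, ⟨hj, hδ⟩, _, h⟩ => ⟨j, hj, δ, hδ, h⟩,
    fun ⟨j, hj, δ, hδ, h⟩ => ⟨I, j, δ, ⟨hj, hδ⟩, rfl, h⟩⟩

theorem card_barrierSupport_le (k d M K : ℕ) : (barrierSupport k d M K).card ≤
    Fintype.card (IndexSet k (d + 1)) * ((M + 1) * (2 * d + 3)) := by
  refine Finset.card_image_le.trans ?_
  rw [Finset.card_product, Finset.card_product, Finset.card_univ, Finset.card_range]
  gcongr
  exact card_displacements_le d K

theorem sigmaProj_notMem_barrierSupport (h0 : 0 ∈ I.1) (hx : 1 ≤ x 0) (hxK : x 0 ≤ K) :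
    sigmaProj I x ∉ barrierSupport k d M K := by
  intro h
  obtain ⟨j, -, δ, hδ, hI⟩ := sigmaProj_mem_barrierSupport_iff.1 h
  have := hI 0 h0
  have := apply_zero_of_mem_displacements hδ
  rw [site_apply_zero] at *
  simp only [Nat.cast_zero, zero_add] at *
  omega

theorem barrier_apply_eq_true (hω : ω ∈ barrier k d M K)
    (h : sigmaProj I x ∈ baseProjections k d M) : ω I (proj I x) = true := by
  obtain ⟨j, hj, hI⟩ := sigmaProj_mem_baseProjections_iff.1 h
  have hsupp : sigmaProj I x ∈ barrierSupport k d M K :=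
    sigmaProj_mem_barrierSupport_iff.2 ⟨j, hj, 0, zero_mem_displacements d K, by simpa using hI⟩
  exact (hω _ hsupp).trans (decide_eq_true h)

theorem hyperplaneConfig_base_eq_true (hω : ω ∈ barrier k d M K) {j : ℕ} (hj : j ≤ M) :
    hyperplaneConfig ω (site d (j, 0)) = true :=
  hyperplaneConfig_eq_true.2 fun _ => barrier_apply_eq_true hω
    (sigmaProj_mem_baseProjections_iff.2 ⟨j, hj, fun _ _ => rfl⟩)

theorem mem_baseProjections_of_open (hω : ω ∈ barrier k d M K)
    (hy : hyperplaneConfig ω y = true) (h : sigmaProj I y ∈ barrierSupport k d M K) :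
    sigmaProj I y ∈ baseProjections k d M :=
  of_decide_eq_true ((hω _ h).symm.trans (hyperplaneConfig_eq_true.1 hy I))

theorem finite_enclosure (hk : 0 < k) (hkd : k ≤ d) (M K : ℕ) : (enclosure k d M K).Finite := by
  refine (Set.finite_Icc (0 : Site (d + 1)) fun _ => (M + K : ℤ)).subset fun x ⟨hx0, hx⟩ => ?_
  have bounds : ∀ i, 0 ≤ x i ∧ x i ≤ M + K := by
    intro i
    cases i using Fin.cases with
    | zero => exact ⟨hx0.1, by linarith [hx0.2]⟩
    | succ i =>
      obtain ⟨I, hiI, h0⟩ :=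
        exists_indexSet_mem_notMem hk (Nat.lt_succ_of_le hkd) (Fin.succ_ne_zero i)
      obtain ⟨j, hj, hI⟩ := sigmaProj_mem_baseProjections_iff.1 (hx I h0)
      have : site d (j, 0) i.succ ≤ j := Nat.cast_le.2 (Nat.count_le _)
      rw [hI _ hiI]
      exact ⟨Nat.cast_nonneg _, by omega⟩
  exact ⟨fun i => (bounds i).1, fun i => (bounds i).2⟩

theorem height_mem_Icc_of_open (hk : 0 < k) (hkd : k ≤ d) (hω : ω ∈ barrier k d M K)
    (hy : hyperplaneConfig ω y = true)
    (hyM : ∀ I : IndexSet k (d + 1), 0 ∉ I.1 → sigmaProj I y ∈ baseProjections k d M)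
    (hheight : y 0 ∈ Set.Icc (-1 : ℤ) (K + 1)) : y 0 ∈ Set.Icc (0 : ℤ) K := by
  by_contra hout
  have hlayer : y 0 = -1 ∨ y 0 = K + 1 := by
    simp only [Set.mem_Icc] at hheight hout
    omega
  obtain ⟨I, -, hI0⟩ := exists_indexSet_mem_notMem hk (Nat.lt_succ_of_le hkd)
    (Fin.succ_ne_zero (⟨0, hk.trans_le hkd⟩ : Fin d))
  obtain ⟨J, hJ0, hJI⟩ := exists_indexSet_mem_subset_insert hk I 0
  obtain ⟨j, hj, hyI⟩ := sigmaProj_mem_baseProjections_iff.1 (hyM I hI0)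
  have hsupp : sigmaProj J y ∈ barrierSupport k d M K := by
    refine sigmaProj_mem_barrierSupport_iff.2
      ⟨j, hj, _, single_zero_mem_displacements hlayer, fun i hi => ?_⟩
    obtain rfl | hiI := Finset.mem_insert.1 (hJI hi)
    · simp [site_apply_zero]
    · rw [hyI i hiI, Pi.single_eq_of_ne (ne_of_mem_of_not_mem hiI hI0), add_zero]
  obtain ⟨j', -, hbase⟩ :=
    sigmaProj_mem_baseProjections_iff.1 (mem_baseProjections_of_open hω hy hsupp)
  have : y 0 = 0 := hbase 0 hJ0
  omega

theorem mem_enclosure_of_adj (hk : 0 < k) (hkd : k ≤ d) (hω : ω ∈ barrier k d M K)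
    (hx : x ∈ enclosure k d M K) (hxy : (lattice (d + 1)).Adj x y)
    (hy : hyperplaneConfig ω y = true) : y ∈ enclosure k d M K := by
  obtain ⟨⟨hx0, hxK⟩, hxM⟩ := hx
  obtain ⟨i, u, hu, rfl⟩ := exists_eq_add_single_of_adj hxy
  cases i using Fin.cases with
  | zero =>
    have hyM : ∀ I : IndexSet k (d + 1), 0 ∉ I.1 →
        sigmaProj I (x + Pi.single 0 u) ∈ baseProjections k d M := by
      intro I hI
      have : sigmaProj I (x + Pi.single 0 u) = sigmaProj I x :=
        sigmaProj_eq_iff.2 ⟨rfl, fun i hi => by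
          rw [Pi.add_apply, Pi.single_eq_of_ne (ne_of_mem_of_not_mem hi hI), add_zero]⟩
      exact this ▸ hxM I hI
    have hu' := abs_le.1 hu.le
    refine ⟨height_mem_Icc_of_open hk hkd hω hy hyM ?_, hyM⟩
    rw [Pi.add_apply, Pi.single_eq_same]
    exact ⟨by omega, by omega⟩
  | succ i =>
    refine ⟨by simpa using ⟨hx0, hxK⟩, fun I hI => mem_baseProjections_of_open hω hy ?_⟩
    obtain ⟨j, hj, hxI⟩ := sigmaProj_mem_baseProjections_iff.1 (hxM I hI)
    exact sigmaProj_mem_barrierSupport_iff.2 ⟨j, hj, _, single_succ_mem_displacements i hu,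
      fun i' hi' => by rw [Pi.add_apply, hxI i' hi']⟩

theorem hyperplaneConfig_notMem_connectedToInfinity (hk : 0 < k) (hkd : k ≤ d)
    (hω : ω ∈ barrier k d M K) : hyperplaneConfig ω ∉ connectedToInfinity (d + 1) := by
  have h0 : (0 : Site (d + 1)) ∈ enclosure k d M K :=
    ⟨by simp, fun I _ => sigmaProj_mem_baseProjections_iff.2
      ⟨0, M.zero_le, fun i _ => by rw [site_zero]⟩⟩
  exact Set.not_infinite.2 ((finite_enclosure hk hkd M K).subset
    (cluster_subset h0 fun _ hx _ => mem_enclosure_of_adj hk hkd hω hx))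

end Barrier

section Crossing

variable {k d M K : ℕ} {ω : ConfigFamily k (d + 1)}

theorem exists_closed_starPath (hd : 0 < d) (hω : ω ∈ barrier k d M K)
    (hK : hyperplaneConfig ω ∉ connectedToBoundary (d + 1) K) :
    ∃ S ∈ starPathSets M K, ∀ z ∈ S, hyperplaneConfig ω (site d z) = false := by
  set η := hyperplaneConfig ω
  set R : Set (ℕ × ℕ) := {z | Connected η 0 (site d z)}
  set C : Set (ℕ × ℕ) := {z | z ∈ Finset.Icc (0, 1) (M, K) ∧ η (site d z) = false}
  have base : ∀ j ≤ M, η (site d (j, 0)) = true := fun j => hyperplaneConfig_base_eq_true hω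
  have bottom : ∀ j ≤ M, (j, 0) ∈ R := by
    intro j
    induction j with
    | zero =>
      exact fun _ => by
        simpa only [R, Set.mem_ofPred_eq, site_zero] using Connected.refl (base 0 M.zero_le)
    | succ j ih =>
      exact fun hj => (ih (by omega) : Connected η 0 (site d (j, 0))).concat
        (lattice_adj_site hd (hasse_adj_right j 0)) (base (j + 1) hj)
  have top : ∀ j ≤ M, (j, K) ∉ R := fun j _ hj =>
    hK (hj.mem_connectedToBoundary ⟨0, le_abs_self _⟩)
  have disjoint : Disjoint R C :=
    Set.disjoint_left.2 fun z hzR hzC => by simpa [hzC.2] using hzR.open_right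
  have boundary : ∀ a ≤ (M, K), ∀ b ≤ (M, K), (SimpleGraph.hasse (ℕ × ℕ)).Adj a b →
      a ∈ R → b ∉ R → b ∈ C := by
    intro a _ b hb hab haR hbR
    have hclosed : η (site d b) = false := by
      by_contra hopen
      exact hbR (haR.concat (lattice_adj_site hd hab) (by simpa using hopen))
    have hpos : b.2 ≠ 0 := fun h => hbR (by simpa [← h] using bottom b.1 hb.1)
    exact ⟨Finset.mem_Icc.2 ⟨⟨b.1.zero_le, Nat.pos_of_ne_zero hpos⟩, hb⟩, hclosed⟩
  obtain ⟨h, h', w, hw⟩ := exists_star_crossing bottom top disjoint boundary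
  obtain ⟨S, hS, hSw⟩ := exists_mem_starPathSets w fun z hz => (hw z hz).1
  exact ⟨S, hS, fun z hz => (hw z (hSw z hz)).2⟩

/-- The `k`-element sets of coordinates that contain the vertical one. -/
abbrev VerticalIndexSet (k d : ℕ) : Type := {I : IndexSet k (d + 1) // 0 ∈ I.1}

theorem exists_closed_projection (hω : ω ∈ barrier k d M K) {z : ℕ × ℕ} (hz : z.1 ≤ M)
    (hclosed : hyperplaneConfig ω (site d z) = false) :
    ∃ I : VerticalIndexSet k d, ω I.1 (proj I.1 (site d z)) = false := by
  obtain ⟨I, hI⟩ : ∃ I, ω I (proj I (site d z)) = false := by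
    rw [← Bool.not_eq_true, hyperplaneConfig_eq_true] at hclosed
    simpa using hclosed
  refine ⟨⟨I, by_contra fun h0 => ?_⟩, hI⟩
  have hbase : sigmaProj I (site d z) ∈ baseProjections k d M :=
    sigmaProj_mem_baseProjections_iff.2 ⟨z.1, hz, fun i hi => by
      cases i using Fin.cases with
      | zero => exact absurd hi h0
      | succ i => rfl⟩
  simp [barrier_apply_eq_true hω hbase] at hI

/-- The projections of the points of the strip indexed by `S`, each to the hyperplane that `f`
assigns to it. -/
def labelledProjections {k d : ℕ} {S : Finset (ℕ × ℕ)} (f : S → VerticalIndexSet k d) :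
    Finset (HyperplaneSite k (d + 1)) :=
  Finset.univ.image fun z => sigmaProj (f z).1 (site d z)

/-- Two points of the strip with the same projection to a hyperplane that contains the vertical
direction and a horizontal one are equal as soon as their first coordinates agree modulo `d`. -/
theorem card_le_mul_card_labelledProjections {d : ℕ} (hd : 0 < d) (hk : 2 ≤ k)
    {S : Finset (ℕ × ℕ)} (f : S → VerticalIndexSet k d) :
    S.card ≤ d * (labelledProjections f).card := by
  rw [← Fintype.card_coe, ← Finset.card_univ]
  refine Finset.card_le_mul_card_image _ _ fun v hv => ?_
  obtain ⟨z₀, -, rfl⟩ := Finset.mem_image.1 hv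
  obtain ⟨i, hi, hi0⟩ : ∃ i ∈ (f z₀).1.1, i ≠ 0 :=
    Finset.exists_mem_ne (by rw [(f z₀).1.2]; exact hk) 0
  obtain ⟨i, rfl⟩ := Fin.exists_succ_eq.2 hi0
  have agree : ∀ z ∈ Finset.univ.filter
      fun z : S => sigmaProj (f z).1 (site d z) = sigmaProj (f z₀).1 (site d z₀),
      site d z 0 = site d z₀ 0 ∧ site d z i.succ = site d z₀ i.succ := by
    intro z hz
    obtain ⟨hf, hz⟩ := sigmaProj_eq_iff.1 (Finset.mem_filter.1 hz).2
    exact ⟨hz _ (f z).2, hz _ (hf ▸ hi)⟩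
  calc
    _ ≤ (Finset.range d).card :=
      Finset.card_le_card_of_injOn (fun z : S => z.1.1 % d)
        (fun z _ => Finset.mem_coe.2 (Finset.mem_range.2 (z.1.1.mod_lt hd)))
        fun z hz z' hz' hmod => Subtype.ext (eq_of_site_eq_of_modEq hmod
          ((agree z hz).1.trans (agree z' hz').1.symm)
          ((agree z hz).2.trans (agree z' hz').2.symm))
    _ = d := Finset.card_range d

theorem disjoint_barrierSupport_labelledProjections {S : Finset (ℕ × ℕ)}
    (hS : S ⊆ Finset.Icc (0, 1) (M, K)) (f : S → VerticalIndexSet k d) :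
    Disjoint (barrierSupport k d M K) (labelledProjections f) := by
  refine Finset.disjoint_right.2 fun v hv => ?_
  obtain ⟨z, -, rfl⟩ := Finset.mem_image.1 hv
  have hz := Finset.mem_Icc.1 (hS z.2)
  exact sigmaProj_notMem_barrierSupport (f z).2 (Nat.one_le_cast.2 hz.1.2) (Nat.cast_le.2 hz.2.2)

theorem exists_mem_agreeOn_labelledProjections {S : Finset (ℕ × ℕ)}
    (hS : S ⊆ Finset.Icc (0, 1) (M, K)) (hω : ω ∈ barrier k d M K)
    (hclosed : ∀ z ∈ S, hyperplaneConfig ω (site d z) = false) :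
    ∃ f : S → VerticalIndexSet k d, ω ∈ agreeOn (labelledProjections f) fun _ => false := by
  choose f hf using fun z : S =>
    exists_closed_projection hω (Finset.mem_Icc.1 (hS z.2)).2.1 (hclosed z z.2)
  exact ⟨f, Finset.forall_mem_image.2 fun z _ => hf z⟩

end Crossing

section ProductLaw

variable {k n : ℕ} {p : IndexSet k n → unitInterval}

/-- The joint law of the independent percolations on the coordinate hyperplanes. -/
noncomputable def productLaw (p : IndexSet k n → unitInterval) : Measure (ConfigFamily k n) :=
  Measure.pi fun I => bernoulliSite (CoordHyperplane I) (p I)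

instance (p : IndexSet k n → unitInterval) : IsProbabilityMeasure (productLaw p) := by
  unfold productLaw
  infer_instance

theorem productLaw_real_le_percolationLaw_real (E : Set (Config (Site n))) :
    (productLaw p).real (hyperplaneConfig ⁻¹' E) ≤ (percolationLaw p).real E :=
  ENNReal.toReal_mono (measure_ne_top _ _)
    (Measure.le_map_apply measurable_hyperplaneConfig.aemeasurable E)

theorem bernoulliMeasure_real_singleton (p : unitInterval) (b : Bool) :
    (bernoulliMeasure true false p).real {b} = if b then (p : ℝ) else 1 - p := by
  cases b
  · exact bernoulliMeasure_real_apply_of_notMem_of_mem _ (.singleton _) (by simp) (by simp)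
  · exact bernoulliMeasure_real_apply_of_mem_of_notMem _ (.singleton _) (by simp) (by simp)

theorem productLaw_real_agreeOn (p : IndexSet k n → unitInterval)
    (F : Finset (HyperplaneSite k n)) (b : HyperplaneSite k n → Bool) :
    (productLaw p).real (agreeOn F b) = ∏ v ∈ F, if b v then (p v.1 : ℝ) else 1 - p v.1 := by
  classical
  let fibre (I : IndexSet k n) : Finset (CoordHyperplane I) :=
    F.preimage (Sigma.mk I) sigma_mk_injective.injOn
  have hF : F = Finset.univ.sigma fibre := by
    ext ⟨I, y⟩
    simp [fibre]
  have hbox : agreeOn F b =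
      Set.univ.pi fun I => Set.pi (fibre I) fun y => {b ⟨I, y⟩} := by
    ext ω
    simp [agreeOn, fibre, Sigma.forall]
  rw [hbox, measureReal_def, productLaw, Measure.pi_pi, ENNReal.toReal_prod, hF,
    Finset.prod_sigma]
  refine Finset.prod_congr rfl fun I _ => ?_
  rw [bernoulliSite, Measure.infinitePi_pi _ (fun _ _ => .singleton _), ENNReal.toReal_prod]
  exact Finset.prod_congr rfl fun y _ => bernoulliMeasure_real_singleton (p I) (b ⟨I, y⟩)

theorem productLaw_real_agreeOn_inter {F G : Finset (HyperplaneSite k n)} (hFG : Disjoint F G)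
    (b c : HyperplaneSite k n → Bool) :
    (productLaw p).real (agreeOn F b ∩ agreeOn G c) =
      (productLaw p).real (agreeOn F b) * (productLaw p).real (agreeOn G c) := by
  classical
  have hc : ∀ v ∈ G, F.piecewise b c v = c v := fun v hv =>
    F.piecewise_eq_of_notMem b c (Finset.disjoint_right.1 hFG hv)
  have hb : ∀ v ∈ F, F.piecewise b c v = b v := fun v => F.piecewise_eq_of_mem b c
  have hinter : agreeOn F b ∩ agreeOn G c = agreeOn (F ∪ G) (F.piecewise b c) := by
    ext ω
    simp only [agreeOn, Set.mem_inter_iff, Set.mem_ofPred_eq, Finset.forall_mem_union]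
    exact and_congr (forall₂_congr fun v hv => by rw [hb v hv])
      (forall₂_congr fun v hv => by rw [hc v hv])
  rw [hinter, productLaw_real_agreeOn, productLaw_real_agreeOn, productLaw_real_agreeOn,
    Finset.prod_union hFG]
  exact congrArg₂ _ (Finset.prod_congr rfl fun v hv => by rw [hb v hv])
    (Finset.prod_congr rfl fun v hv => by rw [hc v hv])

theorem productLaw_real_agreeOn_false_le {ε : ℝ} (hp : ∀ I, 1 - ε ≤ p I)
    (F : Finset (HyperplaneSite k n)) :
    (productLaw p).real (agreeOn F fun _ => false) ≤ ε ^ F.card := by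
  simp only [productLaw_real_agreeOn, Bool.false_eq_true, if_false]
  exact (Finset.prod_le_prod (fun v _ => sub_nonneg.2 (p v.1).2.2)
    fun v _ => sub_le_comm.1 (hp v.1)).trans_eq (Finset.prod_const ε)

theorem pow_card_le_productLaw_real_agreeOn {q : ℝ} (hq : 0 ≤ q)
    (hp : ∀ I, q ≤ min (p I : ℝ) (1 - p I)) (F : Finset (HyperplaneSite k n))
    (b : HyperplaneSite k n → Bool) : q ^ F.card ≤ (productLaw p).real (agreeOn F b) := by
  rw [productLaw_real_agreeOn, ← Finset.prod_const]
  refine Finset.prod_le_prod (fun _ _ => hq) fun v _ => ?_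
  split_ifs
  exacts [(le_min_iff.1 (hp v.1)).1, (le_min_iff.1 (hp v.1)).2]

end ProductLaw

section Estimates

variable {k d M K r : ℕ} {p : IndexSet k (d + 1) → unitInterval} {ε q : ℝ}

theorem pow_le_productLaw_real_barrier (hq : 0 ≤ q) (hq1 : q ≤ 1)
    (hp : ∀ I, q ≤ min (p I : ℝ) (1 - p I)) :
    q ^ (Fintype.card (IndexSet k (d + 1)) * ((M + 1) * (2 * d + 3))) ≤
      (productLaw p).real (barrier k d M K) :=
  (pow_le_pow_of_le_one hq hq1 (card_barrierSupport_le k d M K)).trans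
    (pow_card_le_productLaw_real_agreeOn hq hp _ _)

theorem productLaw_real_barrier_inter_agreeOn_le (hd : 0 < d) (hk : 2 ≤ k) (hε0 : 0 ≤ ε)
    (hε1 : ε ≤ 1) (hp : ∀ I, 1 - ε ≤ p I) {S : Finset (ℕ × ℕ)}
    (hS : S ⊆ Finset.Icc (0, 1) (M, K)) (hcard : S.card = d * r) (f : S → VerticalIndexSet k d) :
    (productLaw p).real (barrier k d M K ∩ agreeOn (labelledProjections f) fun _ => false) ≤
      (productLaw p).real (barrier k d M K) * ε ^ r := by
  have hr : r ≤ (labelledProjections f).card :=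
    Nat.le_of_mul_le_mul_left (hcard ▸ card_le_mul_card_labelledProjections hd hk f) hd
  rw [barrier, productLaw_real_agreeOn_inter (disjoint_barrierSupport_labelledProjections hS f)]
  gcongr
  exact (productLaw_real_agreeOn_false_le hp _).trans (pow_le_pow_of_le_one hε0 hε1 hr)

theorem productLaw_real_barrier_closed_le (hd : 0 < d) (hk : 2 ≤ k) (hε0 : 0 ≤ ε)
    (hε1 : ε ≤ 1) (hp : ∀ I, 1 - ε ≤ p I) {S : Finset (ℕ × ℕ)}
    (hS : S ⊆ Finset.Icc (0, 1) (M, K)) (hcard : S.card = d * r) :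
    (productLaw p).real
        {ω ∈ barrier k d M K | ∀ z ∈ S, hyperplaneConfig ω (site d z) = false} ≤
      Fintype.card (VerticalIndexSet k d) ^ (d * r) *
        ((productLaw p).real (barrier k d M K) * ε ^ r) := by
  have hsub : {ω ∈ barrier k d M K | ∀ z ∈ S, hyperplaneConfig ω (site d z) = false} ⊆
      ⋃ f ∈ (Finset.univ : Finset (S → VerticalIndexSet k d)),
        barrier k d M K ∩ agreeOn (labelledProjections f) fun _ => false := by
    rintro ω ⟨hω, hclosed⟩
    obtain ⟨f, hf⟩ := exists_mem_agreeOn_labelledProjections hS hω hclosed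
    exact Set.mem_biUnion (Finset.mem_univ f) ⟨hω, hf⟩
  calc
    _ ≤ ∑ f : S → VerticalIndexSet k d, (productLaw p).real
          (barrier k d M K ∩ agreeOn (labelledProjections f) fun _ => false) :=
      (measureReal_mono hsub (measure_ne_top _ _)).trans (measureReal_biUnion_finset_le _ _)
    _ ≤ Fintype.card (S → VerticalIndexSet k d) •
          ((productLaw p).real (barrier k d M K) * ε ^ r) :=
      Finset.sum_le_card_nsmul _ _ _ fun f _ =>
        productLaw_real_barrier_inter_agreeOn_le hd hk hε0 hε1 hp hS hcard f
    _ = _ := by rw [nsmul_eq_mul, Fintype.card_fun, Fintype.card_coe, hcard, Nat.cast_pow]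

theorem productLaw_real_barrier_diff_crossing_le (hd : 0 < d) (hk : 2 ≤ k) (hM : M + 1 = d * r)
    (hε0 : 0 ≤ ε) (hε1 : ε ≤ 1) (hp : ∀ I, 1 - ε ≤ p I) :
    (productLaw p).real
        (barrier k d M K \ hyperplaneConfig ⁻¹' connectedToBoundary (d + 1) K) ≤
      K * (8 * Fintype.card (VerticalIndexSet k d)) ^ (d * r) *
        ((productLaw p).real (barrier k d M K) * ε ^ r) := by
  have hsub : barrier k d M K \ hyperplaneConfig ⁻¹' connectedToBoundary (d + 1) K ⊆
      ⋃ S ∈ starPathSets M K,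
        {ω ∈ barrier k d M K | ∀ z ∈ S, hyperplaneConfig ω (site d z) = false} := by
    rintro ω ⟨hω, hK⟩
    obtain ⟨S, hS, hclosed⟩ := exists_closed_starPath hd hω hK
    exact Set.mem_biUnion hS ⟨hω, hclosed⟩
  have hpaths : ((starPathSets M K).card : ℝ) ≤ K * 8 ^ (d * r) := by
    have := (card_starPathSets_le M K).trans
      (Nat.mul_le_mul_left K (Nat.pow_le_pow_right (by norm_num) (M.le_succ.trans_eq hM)))
    exact_mod_cast this
  calc
    _ ≤ ∑ S ∈ starPathSets M K, (productLaw p).real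
          {ω ∈ barrier k d M K | ∀ z ∈ S, hyperplaneConfig ω (site d z) = false} :=
      (measureReal_mono hsub (measure_ne_top _ _)).trans (measureReal_biUnion_finset_le _ _)
    _ ≤ (starPathSets M K).card • (Fintype.card (VerticalIndexSet k d) ^ (d * r) *
          ((productLaw p).real (barrier k d M K) * ε ^ r)) :=
      Finset.sum_le_card_nsmul _ _ _ fun S hS =>
        have hS := (Finset.mem_filter.1 hS).2
        productLaw_real_barrier_closed_le hd hk hε0 hε1 hp hS.2 (hS.1.trans hM)
    _ ≤ K * 8 ^ (d * r) * (Fintype.card (VerticalIndexSet k d) ^ (d * r) *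
          ((productLaw p).real (barrier k d M K) * ε ^ r)) := by
      rw [nsmul_eq_mul]
      gcongr
    _ = _ := by ring

/-- The bound on the densities of the closed points, `1 / (2 (8N)ᵈ)` with `N` the number of
hyperplanes that contain the vertical direction, below which the union bound over the labelled
`*`-connected paths of closed points in the strip succeeds. -/
noncomputable def closedThreshold (k d : ℕ) : ℝ :=
  1 / (2 * (8 * Fintype.card (VerticalIndexSet k d)) ^ d)

theorem one_le_card_verticalIndexSet (hk : 0 < k) (hkd : k ≤ d) :
    (1 : ℝ) ≤ Fintype.card (VerticalIndexSet k d) := by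
  obtain ⟨I, hI, -⟩ := exists_indexSet_mem_notMem hk (Nat.lt_succ_of_le hkd)
    (Fin.succ_ne_zero (⟨0, hk.trans_le hkd⟩ : Fin d)).symm
  have : Nonempty (VerticalIndexSet k d) := ⟨⟨I, hI⟩⟩
  exact Nat.one_le_cast.2 Fintype.card_pos

theorem closedThreshold_pos (hk : 0 < k) (hkd : k ≤ d) : 0 < closedThreshold k d := by
  have := one_le_card_verticalIndexSet hk hkd
  unfold closedThreshold
  positivity

theorem closedThreshold_le_one (hk : 0 < k) (hkd : k ≤ d) : closedThreshold k d ≤ 1 := by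
  have hN := one_le_card_verticalIndexSet hk hkd
  have : 1 ≤ (8 * Fintype.card (VerticalIndexSet k d) : ℝ) ^ d :=
    one_le_pow₀ (by linarith)
  exact div_le_one_of_le₀ (by linarith) (by linarith)

theorem pow_mul_closedThreshold_pow (hk : 0 < k) (hkd : k ≤ d) (r : ℕ) :
    (8 * Fintype.card (VerticalIndexSet k d) : ℝ) ^ (d * r) * closedThreshold k d ^ r =
      1 / 2 ^ r := by
  have := one_le_card_verticalIndexSet hk hkd
  rw [pow_mul, ← mul_pow, closedThreshold, ← one_div_pow]
  congr 1
  field_simp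

theorem half_productLaw_real_barrier_le (hk : 2 ≤ k) (hkd : k ≤ d) (hM : M + 1 = d * r)
    (hK : 2 * K ≤ 2 ^ r) (hp : ∀ I, 1 - closedThreshold k d ≤ p I) :
    (productLaw p).real (barrier k d M K) / 2 ≤
      (percolationLaw p).real (connectedToBoundary (d + 1) K ∩ (connectedToInfinity (d + 1))ᶜ) := by
  have hk0 : 0 < k := by omega
  set B := barrier k d M K
  set E : Set (ConfigFamily k (d + 1)) := hyperplaneConfig ⁻¹' connectedToBoundary (d + 1) K
  have hdiff : (productLaw p).real (B \ E) ≤ (productLaw p).real B / 2 :=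
    calc
      _ ≤ K * (8 * Fintype.card (VerticalIndexSet k d)) ^ (d * r) *
            ((productLaw p).real B * closedThreshold k d ^ r) :=
        productLaw_real_barrier_diff_crossing_le (by omega) hk hM
          (closedThreshold_pos hk0 hkd).le (closedThreshold_le_one hk0 hkd) hp
      _ = (2 * K / 2 ^ r) * ((productLaw p).real B / 2) := by
        linear_combination K * (productLaw p).real B * pow_mul_closedThreshold_pow hk0 hkd r
      _ ≤ 1 * ((productLaw p).real B / 2) := by
        gcongr
        exact div_le_one_of_le₀ (by exact_mod_cast hK) (by positivity)
      _ = _ := one_mul _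
  have hsub : B ∩ E ⊆ hyperplaneConfig ⁻¹'
      (connectedToBoundary (d + 1) K ∩ (connectedToInfinity (d + 1))ᶜ) := fun ω hω =>
    ⟨hω.2, hyperplaneConfig_notMem_connectedToInfinity hk0 hkd hω.1⟩
  have hinter : (productLaw p).real (B ∩ E) ≤ (percolationLaw p).real
      (connectedToBoundary (d + 1) K ∩ (connectedToInfinity (d + 1))ᶜ) :=
    (measureReal_mono hsub).trans (productLaw_real_le_percolationLaw_real _)
  have hsplit : (productLaw p).real B ≤
      (productLaw p).real (B ∩ E) + (productLaw p).real (B \ E) := by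
    simpa only [Set.inter_union_sdiff] using
      measureReal_union_le (μ := productLaw p) (B ∩ E) (B \ E)
  linarith

theorem half_pow_le_percolationLaw_real (hk : 2 ≤ k) (hkd : k ≤ d) {K r : ℕ} (hK0 : 0 < K)
    (hK : 2 * K ≤ 2 ^ r) (hp : ∀ I, 1 - closedThreshold k d ≤ p I) (hq : 0 ≤ q) (hq1 : q ≤ 1)
    (hqp : ∀ I, q ≤ min (p I : ℝ) (1 - p I)) :
    (q ^ (Fintype.card (IndexSet k (d + 1)) * (d * (2 * d + 3)))) ^ r / 2 ≤
      (percolationLaw p).real (connectedToBoundary (d + 1) K ∩ (connectedToInfinity (d + 1))ᶜ) := by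
  have hr : r ≠ 0 := by
    rintro rfl
    omega
  have hM : d * r - 1 + 1 = d * r := Nat.sub_add_cancel
    (Nat.mul_pos (by omega) (Nat.pos_of_ne_zero hr))
  refine le_trans ?_ (half_productLaw_real_barrier_le hk hkd hM hK hp)
  have := pow_le_productLaw_real_barrier (M := d * r - 1) (K := K) hq hq1 hqp
  rw [hM] at this
  rw [← pow_mul]
  convert div_le_div_of_nonneg_right this zero_le_two using 3
  ring

theorem exists_pow_le_percolationLaw_real (hk : 2 ≤ k) (hkd : k ≤ d)
    (hp : ∀ I, 1 - closedThreshold k d < p I ∧ (p I : ℝ) < 1) :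
    ∃ Q : ℝ, 0 < Q ∧ Q < 1 ∧ ∀ K > 0, ∀ r, 2 * K ≤ 2 ^ r → Q ^ r / 2 ≤
      (percolationLaw p).real
        (connectedToBoundary (d + 1) K ∩ (connectedToInfinity (d + 1))ᶜ) := by
  have hk0 : 0 < k := by omega
  obtain ⟨I, -⟩ := exists_indexSet_mem_notMem hk0 (Nat.lt_succ_of_le hkd)
    (Fin.succ_ne_zero (⟨0, hk0.trans_le hkd⟩ : Fin d))
  have : Nonempty (IndexSet k (d + 1)) := ⟨I⟩
  obtain ⟨I₀, hI₀⟩ := Finite.exists_min fun I => min (p I : ℝ) (1 - p I)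
  set q := min (p I₀ : ℝ) (1 - p I₀)
  have hε := closedThreshold_le_one hk0 hkd
  have hq0 : 0 < q := lt_min (by linarith [(hp I₀).1]) (sub_pos.2 (hp I₀).2)
  have hq1 : q < 1 := (min_le_left _ _).trans_lt (hp I₀).2
  have hexp : Fintype.card (IndexSet k (d + 1)) * (d * (2 * d + 3)) ≠ 0 :=
    mul_ne_zero Fintype.card_ne_zero (mul_ne_zero (by omega) (by omega))
  exact ⟨_, pow_pos hq0 _, pow_lt_one₀ hq0.le hq1 hexp, fun K hK0 r hK =>
    half_pow_le_percolationLaw_real hk hkd hK0 hK (fun I => (hp I).1.le) hq0.le hq1.le hI₀⟩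

end Estimates

theorem exists_mul_rpow_neg_le_of_pow_le {Q : ℝ} (hQ0 : 0 < Q) (hQ1 : Q < 1) {f : ℕ → ℝ}
    (hf : ∀ K > 0, ∀ r, 2 * K ≤ 2 ^ r → Q ^ r / 2 ≤ f K) :
    ∃ c α : ℝ, 0 < c ∧ 0 < α ∧ ∀ K : ℕ, 0 < K → c * (K : ℝ) ^ (-α) ≤ f K := by
  set α := -Real.logb 2 Q
  have hα : 0 < α := neg_pos.2 (Real.logb_neg one_lt_two hQ0 hQ1)
  refine ⟨4 ^ (-α) / 2, α, by positivity, hα, fun K hK => ?_⟩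
  set r := Nat.log 2 K + 2
  have hr : 2 * K ≤ 2 ^ r := by
    have : K < 2 ^ (Nat.log 2 K + 1) := Nat.lt_pow_succ_log_self one_lt_two K
    rw [show r = Nat.log 2 K + 1 + 1 from rfl, pow_succ]
    omega
  have hr4 : (2 : ℝ) ^ r ≤ 4 * K := by
    have : 2 ^ Nat.log 2 K ≤ K := Nat.pow_log_le_self 2 hK.ne'
    have : 2 ^ r ≤ 4 * K := by
      rw [pow_add]
      omega
    exact_mod_cast this
  calc
    4 ^ (-α) / 2 * (K : ℝ) ^ (-α) = (4 * K : ℝ) ^ (-α) / 2 := by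
      rw [Real.mul_rpow (by norm_num) K.cast_nonneg]
      ring
    _ ≤ ((2 : ℝ) ^ r) ^ (-α) / 2 := by
      gcongr ?_ / 2
      exact Real.rpow_le_rpow_of_nonpos (by positivity) hr4 (neg_nonpos.2 hα.le)
    _ = Q ^ r / 2 := by
      rw [neg_neg, ← Real.rpow_natCast, ← Real.rpow_mul zero_le_two, mul_comm,
        Real.rpow_mul zero_le_two, Real.rpow_logb two_pos (by norm_num) hQ0, Real.rpow_natCast]
    _ ≤ f K := hf K hK r hr

end HyperplanePercolation

theorem mainTheorem3 (n k : ℕ) (hn : 3 ≤ n) (hk : 2 ≤ k) (hkn : k ≤ n - 1) :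
    ∃ ε : ℝ, 0 < ε ∧
      ∀ p : HyperplanePercolation.IndexSet k n → unitInterval,
        (∀ I, 1 - ε < (p I : ℝ) ∧ (p I : ℝ) < 1) →
        ∃ c α : ℝ, 0 < c ∧ 0 < α ∧
          ∀ K : ℕ, 0 < K →
            c * (K : ℝ) ^ (-α) ≤
              (HyperplanePercolation.percolationLaw p).real
                (HyperplanePercolation.connectedToBoundary n K ∩
                  (HyperplanePercolation.connectedToInfinity n)ᶜ) := by
  obtain ⟨d, rfl⟩ : ∃ d, n = d + 1 := ⟨n - 1, by omega⟩
  have hkd : k ≤ d := hkn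
  refine ⟨HyperplanePercolation.closedThreshold k d,
    HyperplanePercolation.closedThreshold_pos (by omega) hkd, fun p hp => ?_⟩
  obtain ⟨Q, hQ0, hQ1, hQ⟩ :=
    HyperplanePercolation.exists_pow_le_percolationLaw_real hk hkd hp
  exact HyperplanePercolation.exists_mul_rpow_neg_le_of_pow_le hQ0 hQ1 hQ
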